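/- Let $\Gamma$ be a subgroup of finite index of $\mathrm{SL}_2(\mathbb{Z})$, acting on the cusps $\mathbb{Q}\cup\{\infty\}$ by Möbius transformations, and write $\mathfrak{a}\sim\mathfrak{b}$ if $\mathfrak{b}=\gamma(\mathfrak{a})$ for some $\gamma\in\Gamma$. Let $\mathfrak{a}\in\mathbb{Q}\cup\{\infty\}$ and let $\tau\ge 2$ be a real number. Let $A_\tau^{\mathfrak{a}}$ be the set of all $x\in\mathbb{R}$ for which there is a constant $C$, which may depend on $x$, such that $$\left|x-\frac{p}{q}\right|\le \frac{C}{q^{\tau}}$$ for infinitely many rational numbers $p/q\sim\mathfrak{a}$, written in lowest terms with $q>0$. Then the Hausdorff dimension of $A_\tau^{\mathfrak{a}}$ is $2/\tau$. Moreover, $\mathcal{H}^{2/\tau}(A_\tau^{\mathfrak{a}})=\infty$, where $\mathcal{H}^t$ denotes the $t$-dimensional Hausdorff outer measure on $\mathbb{R}$. -/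

import Mathlib

open MeasureTheory
open scoped MatrixGroups ENNReal

/-- The action of an integer matrix of determinant one on the cusps, that is on the rational
projective line `ℚ ∪ {∞}`, by Möbius transformations `z ↦ (a z + b) / (c z + d)`. -/
noncomputable def moebius (γ : SL(2, ℤ)) (𝔞 : OnePoint ℚ) : OnePoint ℚ :=
  Matrix.SpecialLinearGroup.mapGL ℚ γ • 𝔞

/-- Two cusps are equivalent modulo `Γ` if some element of `Γ` maps the first to the second. -/
def CuspEquiv (Γ : Subgroup SL(2, ℤ)) (𝔞 𝔟 : OnePoint ℚ) : Prop :=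
  ∃ γ ∈ Γ, 𝔟 = moebius γ 𝔞

/-- The real numbers `x` for which there is a constant `C` (which may depend on `x`) such that
`|x - p / q| ≤ C / q ^ τ` for infinitely many rational numbers `p / q` (written in lowest terms,
with `q > 0`) that are equivalent to the cusp `𝔞` modulo `Γ`. -/
def approxSet (Γ : Subgroup SL(2, ℤ)) (𝔞 : OnePoint ℚ) (τ : ℝ) : Set ℝ :=
  {x : ℝ | ∃ C : ℝ, {r : ℚ | CuspEquiv Γ (r : OnePoint ℚ) 𝔞 ∧
    |x - (r : ℝ)| ≤ C / (r.den : ℝ) ^ τ}.Infinite}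

open Metric Filter Topology

/-! Put s = 2/τ. The upper bound for the dimension is the easy half of Borel–Cantelli: a bounded
interval contains O(q) fractions of denominator q, and balls of radius const · q^(-τ) about them
have summable t-th powers of radii once tτ > 2.

For the measure, `Γ` contains a translation, so the set is periodic and its measure is 0 or ∞. Only
nonvanishing is at stake, and it also gives the lower bound for the dimension. By
`exists_dirichletApprox`, finitely many coset representatives move Dirichlet's approximants into the
orbit of `𝔞` at the cost of a constant factor. For τ = 2 the set then contains all irrationals.

For τ > 2, any cover by balls of small total s-weight is shown to miss a point of the set
(`exists_approximable_notMem_iUnion`). One chooses nested balls of radius q^(-τ) about orbit points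
so that the cover balls meeting each of them weigh less than a fixed proportion of its own s-weight
q^(-2). A cover ball containing the limit point would weigh less than every such q^(-2), which is
impossible.

The inductive step `exists_sub_ball` is a double count. A ball of radius ρ is filled, via Vitali,
with about ρ^(s-1) layers of orbit points, each with ∑ q^(-2) ≳ ρ, so the total is ≳ ρ^s. Later
layers have much smaller balls, avoiding the earlier ones, and hence a cover ball of radius w
meeting several of the τ-balls meets total weight ≲ w^s (`sum_metBy_le`). If all τ-balls were
blocked, the cover would weigh too much on the original ball. -/

/-- The reciprocal of the square of the denominator. -/
noncomputable def invDenSq (r : ℚ) : ℝ := 1 / (r.den : ℝ) ^ 2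

/-- The reciprocal of the `τ`-th power of the denominator. -/
noncomputable def invDenPow (τ : ℝ) (r : ℚ) : ℝ := 1 / (r.den : ℝ) ^ τ

/-- Every irrational number is approximated by elements of `R` of arbitrarily large denominator
with error at most `C` over the square of the denominator. -/
def DirichletApprox (R : Set ℚ) (C : ℝ) : Prop :=
  ∀ x : ℝ, Irrational x → ∀ Q : ℕ, ∃ r ∈ R, Q ≤ r.den ∧ |x - r| ≤ C * invDenSq r

/-! ### Elementary estimates for powers of denominators. -/

lemma den_cast_pos (r : ℚ) : (0 : ℝ) < r.den := by exact_mod_cast r.pos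

lemma one_le_den_cast (r : ℚ) : (1 : ℝ) ≤ r.den := by exact_mod_cast r.pos

lemma invDenSq_pos (r : ℚ) : 0 < invDenSq r := by
  have := den_cast_pos r
  unfold invDenSq; positivity

lemma invDenPow_pos (τ : ℝ) (r : ℚ) : 0 < invDenPow τ r := by
  have := den_cast_pos r
  unfold invDenPow; positivity

lemma invDenSq_le_one (r : ℚ) : invDenSq r ≤ 1 := by
  have := one_le_den_cast r
  unfold invDenSq
  rw [div_le_one (by positivity)]
  exact one_le_pow₀ this

lemma invDenPow_le_one {τ : ℝ} (hτ : 0 ≤ τ) (r : ℚ) : invDenPow τ r ≤ 1 := by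
  have := one_le_den_cast r
  have := den_cast_pos r
  unfold invDenPow
  rw [div_le_one (by positivity)]
  exact Real.one_le_rpow (one_le_den_cast r) hτ

lemma invDenPow_rpow {τ : ℝ} (hτ : 0 < τ) (r : ℚ) : invDenPow τ r ^ (2 / τ) = invDenSq r := by
  have := den_cast_pos r
  unfold invDenPow invDenSq
  rw [Real.div_rpow zero_le_one (by positivity), Real.one_rpow, ← Real.rpow_mul this.le,
    mul_div_cancel₀ _ hτ.ne']
  norm_num

lemma invDenPow_anti {τ : ℝ} (hτ : 0 ≤ τ) {r r' : ℚ} (h : r.den ≤ r'.den) :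
    invDenPow τ r' ≤ invDenPow τ r := by
  have := den_cast_pos r
  unfold invDenPow
  apply one_div_le_one_div_of_le (by positivity)
  exact Real.rpow_le_rpow this.le (by exact_mod_cast h) hτ

lemma exists_den_invDenSq_le {η : ℝ} (hη : 0 < η) :
    ∃ Q : ℕ, ∀ r : ℚ, Q ≤ r.den → invDenSq r ≤ η := by
  obtain ⟨Q, hQ⟩ := exists_nat_gt (1 / η)
  refine ⟨Q, fun r hr => ?_⟩
  have h1 := one_le_den_cast r
  have h2 : (Q : ℝ) ≤ r.den := by exact_mod_cast hr
  unfold invDenSq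
  rw [div_le_iff₀ (by positivity)]
  rw [div_lt_iff₀ hη] at hQ
  have h3 : (Q : ℝ) * η ≤ (r.den : ℝ) ^ 2 * η :=
    mul_le_mul_of_nonneg_right (h2.trans (by nlinarith)) hη.le
  linarith

lemma exists_den_invDenPow_le {τ η : ℝ} (hτ : 2 < τ) (hη : 0 < η) :
    ∃ Q : ℕ, ∀ r : ℚ, Q ≤ r.den → invDenPow τ r ≤ η * invDenSq r := by
  have ht : Tendsto (fun n : ℕ => (n : ℝ) ^ (-(τ - 2))) atTop (𝓝 0) :=
    (tendsto_rpow_neg_atTop (by linarith)).comp tendsto_natCast_atTop_atTop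
  obtain ⟨Q, hQ⟩ := eventually_atTop.1 (ht.eventually_le_const hη)
  refine ⟨Q, fun r hr => ?_⟩
  have hp := den_cast_pos r
  have h := hQ _ hr
  have : invDenPow τ r = (r.den : ℝ) ^ (-(τ - 2)) * invDenSq r := by
    unfold invDenPow invDenSq
    rw [one_div, one_div, ← Real.rpow_neg hp.le, ← Real.rpow_natCast, ← Real.rpow_neg hp.le,
      ← Real.rpow_add hp]
    congr 1; push_cast; ring
  rw [this]
  exact mul_le_mul_of_nonneg_right h (invDenSq_pos r).le

/-! ### Packing and Vitali covering. -/

lemma sum_radius_le {T : Finset ℚ} {a : ℚ → ℝ} (ha : ∀ r ∈ T, 0 ≤ a r)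
    (hd : (T : Set ℚ).PairwiseDisjoint fun r => closedBall (r : ℝ) (a r))
    {y ρ : ℝ} (hρ : 0 ≤ ρ) (hsub : ∀ r ∈ T, closedBall (r : ℝ) (a r) ⊆ closedBall y ρ) :
    ∑ r ∈ T, a r ≤ ρ := by
  have h1 : volume (⋃ r ∈ T, closedBall (r : ℝ) (a r)) ≤ volume (closedBall y ρ) :=
    measure_mono (Set.iUnion₂_subset hsub)
  rw [measure_biUnion_finset hd (fun _ _ => measurableSet_closedBall), Real.volume_closedBall] at h1
  simp only [Real.volume_closedBall] at h1
  rw [← ENNReal.ofReal_sum_of_nonneg (fun r hr => mul_nonneg zero_le_two (ha r hr))] at h1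
  rw [ENNReal.ofReal_le_ofReal_iff (by positivity), ← Finset.mul_sum] at h1
  linarith

/-- Inside an open set, the Vitali covering lemma extracts finitely many disjoint balls around
elements of `R` that fill a fixed proportion of the measure. -/
lemma exists_disjoint_balls {R : Set ℚ} {C : ℝ} (hC : 0 < C) (h : DirichletApprox R C)
    {G : Set ℝ} (hG : IsOpen G) {V : ℝ} (hV0 : 0 ≤ V) (hV : ENNReal.ofReal V < volume G) (Q : ℕ) :
    ∃ T : Finset ℚ, (∀ r ∈ T, r ∈ R ∧ Q ≤ r.den ∧ closedBall (r : ℝ) (C * invDenSq r) ⊆ G) ∧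
      (T : Set ℚ).PairwiseDisjoint (fun r => closedBall (r : ℝ) (C * invDenSq r)) ∧
      V ≤ 10 * C * ∑ r ∈ T, invDenSq r := by
  let t : Set ℚ := {r | r ∈ R ∧ Q ≤ r.den ∧ closedBall (r : ℝ) (C * invDenSq r) ⊆ G}
  obtain ⟨u, hut, hud, huc⟩ := Vitali.exists_disjoint_subfamily_covering_enlargement_closedBall
    t (fun r : ℚ => (r : ℝ)) (fun r => C * invDenSq r) C
    (fun r _ => mul_le_of_le_one_right hC.le (invDenSq_le_one r)) 5 (by norm_num)
  have hcov : G ⊆ (Set.range ((↑) : ℚ → ℝ)) ∪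
      ⋃ r ∈ u, closedBall (r : ℝ) (5 * (C * invDenSq r)) := by
    intro x hx
    by_cases hxi : Irrational x
    · right
      obtain ⟨ε, hε, hball⟩ := Metric.isOpen_iff.1 hG x hx
      obtain ⟨Q', hQ'⟩ := exists_den_invDenSq_le (η := ε / (4 * C)) (by positivity)
      obtain ⟨r, hr, hden, hxr⟩ := h x hxi (max Q Q')
      have hw := hQ' r (le_trans (le_max_right _ _) hden)
      rw [le_div_iff₀ (by positivity)] at hw
      have hrt : r ∈ t := by
        refine ⟨hr, le_trans (le_max_left _ _) hden, fun y hy => hball ?_⟩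
        rw [mem_closedBall, Real.dist_eq] at hy
        rw [mem_ball, Real.dist_eq]
        have := abs_sub_le y r x
        rw [abs_sub_comm (r : ℝ) x] at this
        nlinarith
      obtain ⟨b, hb, hsub⟩ := huc r hrt
      refine Set.mem_biUnion hb (hsub ?_)
      rw [mem_closedBall, Real.dist_eq]
      exact hxr
    · left
      simpa [Irrational] using hxi
  have hvol : volume G ≤ ∑' r : u, ENNReal.ofReal (10 * C * invDenSq r) := by
    calc volume G ≤ volume (Set.range ((↑) : ℚ → ℝ)) +
          volume (⋃ r ∈ u, closedBall (r : ℝ) (5 * (C * invDenSq r))) :=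
          (measure_mono hcov).trans (measure_union_le _ _)
      _ ≤ 0 + ∑' r : u, volume (closedBall ((r : ℚ) : ℝ) (5 * (C * invDenSq r))) := by
          gcongr
          · rw [(Set.countable_range _).measure_zero]
          · exact measure_biUnion_le volume u.to_countable _
      _ = _ := by
          rw [zero_add]
          congr 1; ext r
          rw [Real.volume_closedBall]; congr 1; ring
  have hlt := hV.trans_le hvol
  -- The Vitali family may be infinite; the strict inequality passes to a finite partial sum.
  rw [ENNReal.tsum_eq_iSup_sum, lt_iSup_iff] at hlt
  obtain ⟨S, hS⟩ := hlt
  refine ⟨S.map (Function.Embedding.subtype _), ?_, ?_, ?_⟩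
  · intro r hr
    obtain ⟨a, _, rfl⟩ := Finset.mem_map.1 hr
    exact hut a.2
  · intro r hr r' hr' hne
    obtain ⟨a, _, rfl⟩ := Finset.mem_map.1 hr
    obtain ⟨a', _, rfl⟩ := Finset.mem_map.1 hr'
    exact hud a.2 a'.2 hne
  · rw [Finset.sum_map, Finset.mul_sum]
    rw [← ENNReal.ofReal_sum_of_nonneg
      (fun r _ => by have := invDenSq_pos r; positivity)] at hS
    exact ((ENNReal.ofReal_lt_ofReal_iff_of_nonneg hV0).1 hS).le

/-! ### Layered families. -/

/-- The elements of `F` whose `τ`-ball meets `U`. -/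
noncomputable def metBy (τ : ℝ) (F : Finset ℚ) (U : Set ℝ) : Finset ℚ :=
  open Classical in F.filter fun r => (U ∩ closedBall (r : ℝ) (invDenPow τ r)).Nonempty

lemma mem_metBy {τ : ℝ} {F : Finset ℚ} {U : Set ℝ} {r : ℚ} :
    r ∈ metBy τ F U ↔ r ∈ F ∧ (U ∩ closedBall (r : ℝ) (invDenPow τ r)).Nonempty := by
  simp [metBy]

lemma metBy_subset (τ : ℝ) (F : Finset ℚ) (U : Set ℝ) : metBy τ F U ⊆ F := by
  classical exact Finset.filter_subset _ _

lemma metBy_union [DecidableEq ℚ] (τ : ℝ) (F T : Finset ℚ) (U : Set ℝ) :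
    metBy τ (F ∪ T) U = metBy τ F U ∪ metBy τ T U := by
  ext r; simp only [mem_metBy, Finset.mem_union]; tauto

/-- A finite family of elements of `R` whose `τ`-balls lie in `ball x₀ ρ₀`, consisting of `M` layers
each of which fills a fixed proportion of that ball on the scale of the squared denominators. -/
structure IsLayeredFamily (R : Set ℚ) (C τ x₀ ρ₀ ε : ℝ) (Q M : ℕ) (F : Finset ℚ) : Prop where
  mem : ∀ r ∈ F, r ∈ R
  den : ∀ r ∈ F, Q ≤ r.den
  sub : ∀ r ∈ F, closedBall (r : ℝ) (invDenPow τ r) ⊆ ball x₀ ρ₀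
  sep : ∀ r ∈ F, ∀ r' ∈ F, r ≠ r' → ∀ y ∈ closedBall (r : ℝ) (invDenPow τ r),
    ∀ y' ∈ closedBall (r' : ℝ) (invDenPow τ r'), invDenPow τ r ≤ |y - y'|
  lower : M * (ρ₀ / (20 * C)) ≤ ∑ r ∈ F, invDenSq r
  small : 4 * ∑ r ∈ F, invDenPow τ r ≤ M * (ε * ρ₀)
  -- In the construction the extra term comes from the first layer that `U` meets; each later layer
  -- costs at most `5 / C * d`.
  meet : ∀ (U : Set ℝ) (d : ℝ), (∀ y ∈ U, ∀ y' ∈ U, |y - y'| ≤ d) →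
    (metBy τ F U).Nonempty → ∃ r ∈ metBy τ F U,
      ∑ r ∈ metBy τ F U, invDenSq r ≤ 5 / C * M * d + invDenSq r

lemma abs_sub_ge_of_disjoint_closedBall {a b s t : ℝ} (hs : 0 ≤ s) (ht : 0 ≤ t)
    (h : Disjoint (closedBall a s) (closedBall b t)) : s + t ≤ |a - b| := by
  have := (disjoint_closedBall_closedBall_iff hs ht).1 h
  rw [Real.dist_eq] at this
  exact this.le

section Layer

variable {C τ : ℝ} {T : Finset ℚ}

/-- Disjointness puts the centres at least `C * (invDenSq r + invDenSq r')` apart, and the τ-balls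
use up at most half of that. -/
lemma sep_of_disjoint (hC : 0 < C)
    (hd : (T : Set ℚ).PairwiseDisjoint (fun r => closedBall (r : ℝ) (C * invDenSq r)))
    (hrad : ∀ r ∈ T, invDenPow τ r ≤ C / 2 * invDenSq r)
    {r r' : ℚ} (hr : r ∈ T) (hr' : r' ∈ T) (hne : r ≠ r') {y y' : ℝ}
    (hy : y ∈ closedBall (r : ℝ) (invDenPow τ r))
    (hy' : y' ∈ closedBall (r' : ℝ) (invDenPow τ r')) :
    C / 2 * invDenSq r ≤ |y - y'| := by
  have h1 := abs_sub_ge_of_disjoint_closedBall (by have := invDenSq_pos r; positivity)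
    (by have := invDenSq_pos r'; positivity) (hd hr hr' hne)
  rw [mem_closedBall, Real.dist_eq] at hy hy'
  have h2 := hrad r hr
  have h3 := hrad r' hr'
  have h4 : |(r : ℝ) - r'| ≤ |y - r| + |y - y'| + |y' - r'| := by
    have e1 := abs_sub_le (r : ℝ) y r'
    have e2 := abs_sub_le y y' (r' : ℝ)
    rw [abs_sub_comm (r : ℝ) y] at e1
    linarith
  have := mul_pos hC (invDenSq_pos r')
  linarith

/-- When two τ-balls are met, `sep_of_disjoint` bounds every radius `C * invDenSq r` involved by `2
* d`. The Vitali balls then lie within `4 * d` of a point of `U`, and packing applies. -/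
lemma sum_metBy_le_of_two (hC : 0 < C)
    (hd : (T : Set ℚ).PairwiseDisjoint (fun r => closedBall (r : ℝ) (C * invDenSq r)))
    (hrad : ∀ r ∈ T, invDenPow τ r ≤ C / 2 * invDenSq r)
    {U : Set ℝ} {d : ℝ} (hU : ∀ y ∈ U, ∀ y' ∈ U, |y - y'| ≤ d)
    (h2 : 1 < (metBy τ T U).card) :
    ∑ r ∈ metBy τ T U, invDenSq r ≤ 5 / C * d := by
  have key : ∀ r ∈ metBy τ T U, C / 2 * invDenSq r ≤ d := by
    intro r hr
    obtain ⟨r', hr', hne⟩ := Finset.exists_mem_ne h2 r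
    obtain ⟨hrT, y, hyU, hy⟩ := mem_metBy.1 hr
    obtain ⟨hrT', y', hyU', hy'⟩ := mem_metBy.1 hr'
    exact (sep_of_disjoint hC hd hrad hrT hrT' hne.symm hy hy').trans (hU _ hyU _ hyU')
  obtain ⟨r₀, hr₀⟩ := Finset.card_pos.1 (by omega : 0 < (metBy τ T U).card)
  obtain ⟨-, y₀, hy₀U, -⟩ := mem_metBy.1 hr₀
  have hd0 : 0 ≤ d := (abs_nonneg _).trans (hU _ hy₀U _ hy₀U)
  have h := sum_radius_le (T := metBy τ T U) (a := fun r => C * invDenSq r) (y := y₀)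
    (ρ := 5 * d) (fun r _ => by have := invDenSq_pos r; positivity)
    (hd.subset (by exact_mod_cast metBy_subset τ T U)) (by positivity) ?_
  · rw [← Finset.mul_sum] at h
    rw [div_mul_eq_mul_div, le_div_iff₀ hC]
    linarith
  · intro r hr z hz
    obtain ⟨hrT, y, hyU, hy⟩ := mem_metBy.1 hr
    have h1 := key r hr
    have h3 := hrad r hrT
    rw [mem_closedBall, Real.dist_eq] at hy hz ⊢
    have e1 := abs_sub_le z (r : ℝ) y₀
    have e2 := abs_sub_le (r : ℝ) y y₀
    have e3 := hU y hyU y₀ hy₀U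
    rw [abs_sub_comm (r : ℝ) y] at e2
    linarith

end Layer

lemma isLayeredFamily_empty (R : Set ℚ) (C τ x₀ ρ₀ ε : ℝ) (Q : ℕ) :
    IsLayeredFamily R C τ x₀ ρ₀ ε Q 0 ∅ where
  mem := by simp
  den := by simp
  sub := by simp
  sep := by simp
  lower := by simp
  small := by simp
  meet := by simp [metBy]

/-- The doubled balls have total length at most `4 * ∑ r ∈ F, invDenPow τ r`, hence at most half the
length of `ball x₀ ρ₀`. -/
lemma lt_volume_diff_balls {τ x₀ ρ₀ : ℝ} (hρ₀ : 0 < ρ₀) {F : Finset ℚ}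
    (hsmall : 4 * ∑ r ∈ F, invDenPow τ r ≤ ρ₀) :
    ENNReal.ofReal (ρ₀ / 2) <
      volume (ball x₀ ρ₀ \ ⋃ r ∈ F, closedBall (r : ℝ) (2 * invDenPow τ r)) := by
  have h1 : volume (⋃ r ∈ F, closedBall (r : ℝ) (2 * invDenPow τ r)) ≤ ENNReal.ofReal ρ₀ := by
    refine (measure_biUnion_finset_le _ _).trans ?_
    simp only [Real.volume_closedBall]
    rw [← ENNReal.ofReal_sum_of_nonneg (fun r _ => by have := invDenPow_pos τ r; positivity)]
    apply ENNReal.ofReal_le_ofReal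
    rw [← Finset.mul_sum, ← Finset.mul_sum]
    linarith
  refine lt_of_lt_of_le ?_ (le_measure_sdiff (μ := volume))
  rw [Real.volume_ball]
  refine lt_of_lt_of_le ?_ (tsub_le_tsub_left h1 _)
  rw [← ENNReal.ofReal_sub _ hρ₀.le, ENNReal.ofReal_lt_ofReal_iff (by linarith)]
  linarith

/-- A layer of sufficiently large denominators may be added to a layered family. -/
lemma IsLayeredFamily.exists_succ {R : Set ℚ} {C τ x₀ ρ₀ ε : ℝ} {Q M : ℕ} {F : Finset ℚ}
    (hF : IsLayeredFamily R C τ x₀ ρ₀ ε Q M F) (hC : 0 < C) (hR : DirichletApprox R C)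
    (hτ : 2 < τ) (hρ₀ : 0 < ρ₀) (hε : 0 < ε) (hM : M * ε ≤ 1) :
    ∃ F', IsLayeredFamily R C τ x₀ ρ₀ ε Q (M + 1) F' := by
  classical
  let G : Set ℝ := ball x₀ ρ₀ \ ⋃ r ∈ F, closedBall (r : ℝ) (2 * invDenPow τ r)
  have hG : IsOpen G := isOpen_ball.sdiff
    (Set.Finite.isClosed_biUnion F.finite_toSet fun r _ => isClosed_closedBall)
  have hvol : ENNReal.ofReal (ρ₀ / 2) < volume G := by
    refine lt_volume_diff_balls hρ₀ (hF.small.trans ?_)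
    nlinarith
  obtain ⟨δ, hδ, hδF⟩ : ∃ δ > 0, ∀ r ∈ F, δ ≤ invDenPow τ r := by
    rcases F.eq_empty_or_nonempty with rfl | hne
    · exact ⟨1, one_pos, by simp⟩
    · obtain ⟨r, -, hr⟩ := Finset.exists_min_image F (invDenPow τ) hne
      exact ⟨_, invDenPow_pos τ r, hr⟩
  -- `Q₁` separates the τ-balls within the new layer, `Q₂` preserves `small`, and `Q₃` makes a
  -- single new term negligible against the smallest earlier radius `δ`.
  obtain ⟨Q₁, hQ₁⟩ := exists_den_invDenPow_le (τ := τ) (η := C / 2) hτ (by positivity)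
  obtain ⟨Q₂, hQ₂⟩ := exists_den_invDenPow_le (τ := τ) (η := ε * C / 4) hτ (by positivity)
  obtain ⟨Q₃, hQ₃⟩ := exists_den_invDenSq_le (η := 5 / C * δ) (by positivity)
  let Q' : ℕ := Q ⊔ Q₁ ⊔ Q₂ ⊔ Q₃ ⊔ F.sup Rat.den
  obtain ⟨T, hT, hTd, hTsum⟩ := exists_disjoint_balls hC hR hG (by positivity) hvol Q'
  have hTQ : ∀ r ∈ T, Q ≤ r.den ∧ Q₁ ≤ r.den ∧ Q₂ ≤ r.den ∧ Q₃ ≤ r.den ∧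
      F.sup Rat.den ≤ r.den := by
    intro r hr
    have := (hT r hr).2.1
    simp only [Q', sup_le_iff] at this
    tauto
  have hrad : ∀ r ∈ T, invDenPow τ r ≤ C / 2 * invDenSq r := fun r hr => hQ₁ r (hTQ r hr).2.1
  have hball : ∀ r ∈ T, closedBall (r : ℝ) (invDenPow τ r) ⊆ closedBall r (C * invDenSq r) := by
    intro r hr
    apply closedBall_subset_closedBall
    have := hrad r hr
    have := mul_pos hC (invDenSq_pos r)
    linarith
  have hTG : ∀ r ∈ T, closedBall (r : ℝ) (invDenPow τ r) ⊆ G := fun r hr =>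
    (hball r hr).trans (hT r hr).2.2
  have hcross : ∀ r ∈ F, ∀ r' ∈ T, ∀ y ∈ closedBall (r : ℝ) (invDenPow τ r),
      ∀ y' ∈ closedBall (r' : ℝ) (invDenPow τ r'), invDenPow τ r ≤ |y - y'| := by
    intro r hr r' hr' y hy y' hy'
    have h1 : y' ∉ closedBall (r : ℝ) (2 * invDenPow τ r) := fun hmem =>
      (hTG r' hr' hy').2 (Set.mem_biUnion hr hmem)
    rw [mem_closedBall, Real.dist_eq] at h1 hy
    have := abs_sub_le y' y r
    rw [abs_sub_comm y' y] at this
    linarith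
  have hden : ∀ r ∈ F, ∀ r' ∈ T, invDenPow τ r' ≤ invDenPow τ r := fun r hr r' hr' =>
    invDenPow_anti (by linarith) ((Finset.le_sup (f := Rat.den) hr).trans (hTQ r' hr').2.2.2.2)
  have hdisj : Disjoint F T := by
    rw [Finset.disjoint_left]
    intro r hr hr'
    have := hcross r hr r hr' r (mem_closedBall_self (invDenPow_pos τ r).le) r
      (mem_closedBall_self (invDenPow_pos τ r).le)
    rw [sub_self, abs_zero] at this
    exact (invDenPow_pos τ r).not_ge this
  have hTtotal : ∑ r ∈ T, C * invDenSq r ≤ ρ₀ :=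
    sum_radius_le (y := x₀) (fun r _ => by have := invDenSq_pos r; positivity) hTd hρ₀.le
      fun r hr => ((hT r hr).2.2.trans Set.sdiff_subset).trans ball_subset_closedBall
  refine ⟨F ∪ T, ?_, ?_, ?_, ?_, ?_, ?_, ?_⟩
  · intro r hr
    rcases Finset.mem_union.1 hr with h | h
    exacts [hF.mem r h, (hT r h).1]
  · intro r hr
    rcases Finset.mem_union.1 hr with h | h
    exacts [hF.den r h, (hTQ r h).1]
  · intro r hr
    rcases Finset.mem_union.1 hr with h | h
    exacts [hF.sub r h, (hTG r h).trans Set.sdiff_subset]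
  · intro r hr r' hr' hne y hy y' hy'
    rcases Finset.mem_union.1 hr with h | h <;> rcases Finset.mem_union.1 hr' with h' | h'
    · exact hF.sep r h r' h' hne y hy y' hy'
    · exact hcross r h r' h' y hy y' hy'
    · rw [abs_sub_comm]
      exact (hden r' h' r h).trans (hcross r' h' r h y' hy' y hy)
    · exact (hrad r h).trans (sep_of_disjoint hC hTd hrad h h' hne hy hy')
  · rw [Finset.sum_union hdisj]
    have h1 := hF.lower
    have h2 : ρ₀ / (20 * C) ≤ ∑ r ∈ T, invDenSq r := by
      rw [div_le_iff₀ (by positivity)]; linarith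
    push_cast
    linarith
  · rw [Finset.sum_union hdisj]
    have h1 := hF.small
    have h2 : ∑ r ∈ T, invDenPow τ r ≤ ∑ r ∈ T, ε / 4 * (C * invDenSq r) :=
      Finset.sum_le_sum fun r hr => (hQ₂ r (hTQ r hr).2.2.1).trans (le_of_eq (by ring))
    rw [← Finset.mul_sum] at h2
    have h3 := mul_le_mul_of_nonneg_left hTtotal (by positivity : 0 ≤ ε / 4)
    push_cast
    linarith
  · intro U d hU hne
    rw [metBy_union] at hne ⊢
    have hdisj' : Disjoint (metBy τ F U) (metBy τ T U) :=
      hdisj.mono (metBy_subset _ _ _) (metBy_subset _ _ _)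
    rw [Finset.sum_union hdisj']
    push_cast
    have hd0 : 0 ≤ d := by
      obtain ⟨r, hr⟩ := hne
      rw [← metBy_union] at hr
      obtain ⟨-, y, hy, -⟩ := mem_metBy.1 hr
      exact (abs_nonneg _).trans (hU y hy y hy)
    have hcd : 0 ≤ 5 / C * M * d := by positivity
    have hcd' : 0 ≤ 5 / C * d := by positivity
    rcases (metBy τ F U).eq_empty_or_nonempty with hF0 | hF0
    · rw [hF0, Finset.empty_union] at hne ⊢
      rw [Finset.sum_empty, zero_add]
      rcases Nat.lt_or_ge 1 (metBy τ T U).card with h2 | h2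
      · obtain ⟨r, hr⟩ := hne
        refine ⟨r, hr, (sum_metBy_le_of_two hC hTd hrad hU h2).trans ?_⟩
        have := invDenSq_pos r
        linarith
      · have hcard : (metBy τ T U).card = 1 := le_antisymm h2 (Finset.card_pos.2 hne)
        obtain ⟨r, hr⟩ := Finset.card_eq_one.1 hcard
        rw [hr]
        refine ⟨r, by simp, ?_⟩
        rw [Finset.sum_singleton]
        linarith
    · obtain ⟨r, hr, hle⟩ := hF.meet U d hU hF0
      refine ⟨r, Finset.mem_union_left _ hr, ?_⟩
      have hTle : ∑ r ∈ metBy τ T U, invDenSq r ≤ 5 / C * d := by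
        rcases Nat.lt_or_ge 1 (metBy τ T U).card with h2 | h2
        · exact sum_metBy_le_of_two hC hTd hrad hU h2
        rcases Nat.lt_or_ge 0 (metBy τ T U).card with h1 | h1
        · obtain ⟨r', hr'⟩ := Finset.card_eq_one.1 (le_antisymm h2 h1)
          have hmem : r' ∈ metBy τ T U := by simp [hr']
          rw [hr', Finset.sum_singleton]
          obtain ⟨hrF, y, hyU, hy⟩ := mem_metBy.1 hr
          obtain ⟨hrT, y', hyU', hy'⟩ := mem_metBy.1 hmem
          -- Meeting an earlier and a new ball forces `δ ≤ d`, so the choice of `Q₃` absorbs the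
          -- single new term.
          have e1 := hcross r hrF r' hrT y hy y' hy'
          have e2 := hU y hyU y' hyU'
          have e3 := hδF r hrF
          refine (hQ₃ r' (hTQ r' hrT).2.2.2.1).trans ?_
          gcongr
          linarith
        · rw [Finset.card_eq_zero.1 (Nat.le_zero.1 h1), Finset.sum_empty]
          exact hcd'
      linarith

lemma exists_isLayeredFamily {R : Set ℚ} {C τ x₀ ρ₀ : ℝ} (hC : 0 < C) (hR : DirichletApprox R C)
    (hτ : 2 < τ) (hρ₀ : 0 < ρ₀) (Q : ℕ) (M : ℕ) :
    ∃ ε F, IsLayeredFamily R C τ x₀ ρ₀ ε Q M F := by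
  have hM1 : (0 : ℝ) < M + 1 := by positivity
  -- With this `ε` the doubled balls occupy at most half of the ball at every one of the `M` stages.
  suffices ∀ m ≤ M, ∃ F, IsLayeredFamily R C τ x₀ ρ₀ (1 / (M + 1)) Q m F from ⟨_, this M le_rfl⟩
  intro m hm
  induction m with
  | zero => exact ⟨∅, isLayeredFamily_empty ..⟩
  | succ m ih =>
    obtain ⟨F, hF⟩ := ih (by omega)
    refine hF.exists_succ hC hR hτ hρ₀ (by positivity) ?_
    rw [mul_one_div, div_le_one hM1]
    have : (m : ℝ) ≤ M := by exact_mod_cast (by omega : m ≤ M)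
    linarith

/-! ### Nested balls avoiding a light cover. -/

/-- The total `s`-weight of those balls of a sequence that meet `B`. -/
noncomputable def meetSum (c ω : ℕ → ℝ) (s : ℝ) (B : Set ℝ) : ℝ≥0∞ :=
  open Classical in
  ∑' n, if (ball (c n) (ω n) ∩ B).Nonempty then ENNReal.ofReal (ω n ^ s) else 0

lemma le_meetSum {c ω : ℕ → ℝ} {s : ℝ} {B : Set ℝ} {n : ℕ}
    (h : (ball (c n) (ω n) ∩ B).Nonempty) : ENNReal.ofReal (ω n ^ s) ≤ meetSum c ω s B := by
  classical
  refine le_trans ?_ (ENNReal.le_tsum n)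
  rw [if_pos h]

/-- The reciprocal of the proportion of weight that a covering must have to block all
sub-balls of a ball. -/
noncomputable def blockingConst (C : ℝ) : ℝ := 10 / C * (20 * C + 1) + 2

lemma two_le_blockingConst {C : ℝ} (hC : 0 < C) : 2 ≤ blockingConst C := by
  unfold blockingConst
  have : 0 ≤ 10 / C * (20 * C + 1) := by positivity
  linarith

/-- The single term in `meet` is the s-th power of a radius that `sep` bounds by `2 * w`. The main
term is of order ρ₀^(s-1) w, at most w^s because `w ≤ ρ₀` and s < 1. -/
lemma sum_metBy_le {R : Set ℚ} {C τ x₀ ρ₀ ε : ℝ} {Q M : ℕ} {F : Finset ℚ}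
    (hF : IsLayeredFamily R C τ x₀ ρ₀ ε Q M F) (hC : 0 < C) (hτ : 2 < τ)
    (hM : (M : ℝ) ≤ (20 * C + 1) * ρ₀ ^ (2 / τ - 1))
    {y w : ℝ} (hw : 0 < w) (hwρ : w ≤ ρ₀) (h2 : 1 < (metBy τ F (ball y w)).card) :
    ∑ r ∈ metBy τ F (ball y w), invDenSq r ≤ blockingConst C * w ^ (2 / τ) := by
  have hs0 : 0 < 2 / τ := by positivity
  have hs1 : 2 / τ < 1 := by rw [div_lt_one (by linarith)]; exact hτ
  have hU : ∀ z ∈ ball y w, ∀ z' ∈ ball y w, |z - z'| ≤ 2 * w := by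
    intro z hz z' hz'
    rw [mem_ball, Real.dist_eq] at hz hz'
    have := abs_sub_le z y z'
    rw [abs_sub_comm y z'] at this
    linarith
  obtain ⟨r, hr, hle⟩ := hF.meet _ _ hU (Finset.card_pos.1 (by omega))
  obtain ⟨r', hr', hne⟩ := Finset.exists_mem_ne h2 r
  obtain ⟨hrF, z, hzU, hz⟩ := mem_metBy.1 hr
  obtain ⟨hrF', z', hzU', hz'⟩ := mem_metBy.1 hr'
  have hrad : invDenPow τ r ≤ 2 * w :=
    (hF.sep r hrF r' hrF' hne.symm z hz z' hz').trans (hU z hzU z' hzU')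
  have h3 : invDenSq r ≤ 2 * w ^ (2 / τ) := by
    rw [← invDenPow_rpow (by linarith : 0 < τ) r]
    calc invDenPow τ r ^ (2 / τ) ≤ (2 * w) ^ (2 / τ) :=
          Real.rpow_le_rpow (invDenPow_pos τ r).le hrad hs0.le
      _ = 2 ^ (2 / τ) * w ^ (2 / τ) := Real.mul_rpow (by norm_num) hw.le
      _ ≤ 2 * w ^ (2 / τ) := by
          gcongr
          calc (2 : ℝ) ^ (2 / τ) ≤ 2 ^ (1 : ℝ) :=
                Real.rpow_le_rpow_of_exponent_le (by norm_num) hs1.le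
            _ = 2 := Real.rpow_one 2
  have h4 : ρ₀ ^ (2 / τ - 1) * w ≤ w ^ (2 / τ) := by
    have : ρ₀ ^ (2 / τ - 1) ≤ w ^ (2 / τ - 1) :=
      Real.rpow_le_rpow_of_nonpos hw hwρ (by linarith)
    calc ρ₀ ^ (2 / τ - 1) * w ≤ w ^ (2 / τ - 1) * w := by gcongr
      _ = w ^ (2 / τ) := by rw [Real.rpow_sub_one hw.ne', div_mul_cancel₀ _ hw.ne']
  have h5 : 5 / C * M * (2 * w) ≤ 10 / C * (20 * C + 1) * w ^ (2 / τ) := by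
    calc 5 / C * M * (2 * w) = 10 / C * (M * w) := by ring
      _ ≤ 10 / C * ((20 * C + 1) * ρ₀ ^ (2 / τ - 1) * w) := by gcongr
      _ = 10 / C * (20 * C + 1) * (ρ₀ ^ (2 / τ - 1) * w) := by ring
      _ ≤ _ := by gcongr
  unfold blockingConst
  linarith

/-- If a sequence of balls carries little weight on a ball `B`, then it carries little weight
on some small ball around an element of `R` inside `B`. -/
lemma exists_sub_ball {R : Set ℚ} {C τ : ℝ} (hC : 0 < C) (hR : DirichletApprox R C) (hτ : 2 < τ)
    {c ω : ℕ → ℝ} (hω : ∀ n, 0 < ω n) {x₀ ρ₀ : ℝ} (hρ₀ : 0 < ρ₀) (hρ₁ : ρ₀ ≤ 1)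
    (h : meetSum c ω (2 / τ) (closedBall x₀ ρ₀) <
      ENNReal.ofReal (1 / blockingConst C * ρ₀ ^ (2 / τ))) (Q : ℕ) :
    ∃ r ∈ R, Q ≤ r.den ∧ closedBall (r : ℝ) (invDenPow τ r) ⊆ closedBall x₀ ρ₀ ∧
      meetSum c ω (2 / τ) (closedBall (r : ℝ) (invDenPow τ r)) <
        ENNReal.ofReal (1 / blockingConst C * invDenPow τ r ^ (2 / τ)) := by
  classical
  have hs0 : 0 < 2 / τ := by positivity
  have hs1 : 2 / τ < 1 := by rw [div_lt_one (by linarith)]; exact hτ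
  have hb2 := two_le_blockingConst hC
  have hb0 : 0 < blockingConst C := by linarith
  -- Each layer contributes at least `ρ₀ / (20 * C)`, so this many layers reach ρ₀^s.
  obtain ⟨ε, F, hF⟩ := exists_isLayeredFamily (x₀ := x₀) hC hR hτ hρ₀ Q
    ⌈20 * C * ρ₀ ^ (2 / τ - 1)⌉₊
  have hM : ((⌈20 * C * ρ₀ ^ (2 / τ - 1)⌉₊ : ℕ) : ℝ) ≤ (20 * C + 1) * ρ₀ ^ (2 / τ - 1) := by
    have h1 : 1 ≤ ρ₀ ^ (2 / τ - 1) :=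
      Real.one_le_rpow_of_pos_of_le_one_of_nonpos hρ₀ hρ₁ (by linarith)
    have h2 := (Nat.ceil_lt_add_one (by positivity : 0 ≤ 20 * C * ρ₀ ^ (2 / τ - 1))).le
    linarith
  by_contra hcon
  push Not at hcon
  have hfail : ∀ r ∈ F, ENNReal.ofReal (1 / blockingConst C * invDenSq r) ≤
      meetSum c ω (2 / τ) (closedBall (r : ℝ) (invDenPow τ r)) := by
    intro r hr
    rw [← invDenPow_rpow (by linarith : 0 < τ) r]
    exact hcon r (hF.mem r hr) (hF.den r hr) ((hF.sub r hr).trans ball_subset_closedBall)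
  -- Charges for the double count: a cover ball meeting several τ-balls pays each of them its whole
  -- threshold, one meeting a single τ-ball pays its own weight. Every row then reaches its
  -- threshold, and no column exceeds the weight of its cover ball.
  let g : ℕ → ℚ → ℝ≥0∞ := fun n r =>
    if r ∈ metBy τ F (ball (c n) (ω n)) then
      if 1 < (metBy τ F (ball (c n) (ω n))).card then
        ENNReal.ofReal (1 / blockingConst C * invDenSq r)
      else ENNReal.ofReal (ω n ^ (2 / τ))
    else 0
  have hrow : ∀ r ∈ F, ENNReal.ofReal (1 / blockingConst C * invDenSq r) ≤ ∑' n, g n r := by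
    intro r hr
    by_cases hbig : ∃ n, r ∈ metBy τ F (ball (c n) (ω n)) ∧
        1 < (metBy τ F (ball (c n) (ω n))).card
    · obtain ⟨n, hn, hn'⟩ := hbig
      refine le_trans ?_ (ENNReal.le_tsum n)
      simp only [g]
      rw [if_pos hn, if_pos hn']
    · push Not at hbig
      refine (hfail r hr).trans (le_of_eq ?_)
      unfold meetSum
      congr 1
      ext n
      by_cases hn : r ∈ metBy τ F (ball (c n) (ω n))
      · simp only [g]
        rw [if_pos hn, if_neg (hbig n hn).not_gt, if_pos (mem_metBy.1 hn).2]
      · simp only [g]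
        rw [if_neg hn, if_neg fun h => hn (mem_metBy.2 ⟨hr, h⟩)]
  have hcol : ∀ n, ∑ r ∈ F, g n r ≤
      if (ball (c n) (ω n) ∩ closedBall x₀ ρ₀).Nonempty then ENNReal.ofReal (ω n ^ (2 / τ))
      else 0 := by
    intro n
    have hsum : ∑ r ∈ F, g n r = ∑ r ∈ metBy τ F (ball (c n) (ω n)),
        if 1 < (metBy τ F (ball (c n) (ω n))).card then
          ENNReal.ofReal (1 / blockingConst C * invDenSq r)
        else ENNReal.ofReal (ω n ^ (2 / τ)) := by
      simp only [g]
      rw [Finset.sum_ite_mem, Finset.inter_eq_right.2 (metBy_subset _ _ _)]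
    rw [hsum]
    rcases (metBy τ F (ball (c n) (ω n))).eq_empty_or_nonempty with h0 | ⟨r, hr⟩
    · rw [h0]; simp
    have hmeet : (ball (c n) (ω n) ∩ closedBall x₀ ρ₀).Nonempty := by
      obtain ⟨hrF, z, hz, hz'⟩ := mem_metBy.1 hr
      exact ⟨z, hz, ball_subset_closedBall (hF.sub r hrF hz')⟩
    rw [if_pos hmeet]
    by_cases h2 : 1 < (metBy τ F (ball (c n) (ω n))).card
    · simp only [if_pos h2]
      -- One cover ball alone already weighs less than ρ₀^s, which bounds its radius by `ρ₀`.
      have hlt := (le_meetSum (s := 2 / τ) hmeet).trans_lt h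
      rw [ENNReal.ofReal_lt_ofReal_iff (by positivity)] at hlt
      have hwρ : ω n ≤ ρ₀ := by
        by_contra hgt
        push Not at hgt
        have h3 := Real.rpow_le_rpow hρ₀.le hgt.le hs0.le
        have h4 : 1 / blockingConst C ≤ 1 := by rw [div_le_one hb0]; linarith
        have h5 := mul_le_mul_of_nonneg_right h4 (Real.rpow_nonneg hρ₀.le (2 / τ))
        linarith
      rw [← ENNReal.ofReal_sum_of_nonneg (fun r _ => by have := invDenSq_pos r; positivity),
        ← Finset.mul_sum]
      apply ENNReal.ofReal_le_ofReal
      rw [one_div, inv_mul_le_iff₀ hb0]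
      exact sum_metBy_le hF hC hτ hM (hω n) hwρ h2
    · simp only [if_neg h2]
      rw [Finset.sum_const]
      have hcard : (metBy τ F (ball (c n) (ω n))).card = 1 :=
        le_antisymm (not_lt.1 h2) (Finset.card_pos.2 ⟨r, hr⟩)
      rw [hcard, one_smul]
  have htotal : ENNReal.ofReal (1 / blockingConst C * ρ₀ ^ (2 / τ)) ≤
      meetSum c ω (2 / τ) (closedBall x₀ ρ₀) := by
    calc ENNReal.ofReal (1 / blockingConst C * ρ₀ ^ (2 / τ))
        ≤ ENNReal.ofReal (∑ r ∈ F, 1 / blockingConst C * invDenSq r) := by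
          apply ENNReal.ofReal_le_ofReal
          rw [← Finset.mul_sum]
          gcongr
          refine le_trans ?_ hF.lower
          have h1 := Nat.le_ceil (20 * C * ρ₀ ^ (2 / τ - 1))
          calc ρ₀ ^ (2 / τ) = 20 * C * ρ₀ ^ (2 / τ - 1) * (ρ₀ / (20 * C)) := by
                rw [Real.rpow_sub_one hρ₀.ne']; field_simp
            _ ≤ _ := by gcongr
      _ = ∑ r ∈ F, ENNReal.ofReal (1 / blockingConst C * invDenSq r) :=
          ENNReal.ofReal_sum_of_nonneg (fun r _ => by have := invDenSq_pos r; positivity)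
      _ ≤ ∑ r ∈ F, ∑' n, g n r := Finset.sum_le_sum hrow
      _ = ∑' n, ∑ r ∈ F, g n r := (Summable.tsum_finsetSum fun _ _ => ENNReal.summable).symm
      _ ≤ _ := ENNReal.tsum_le_tsum hcol
  exact h.not_ge htotal

/-- A sequence of balls of small total `s`-weight, `s = 2 / τ`, misses some number that is
approximable to order `τ` by elements of `R`. -/
lemma exists_approximable_notMem_iUnion {R : Set ℚ} {C τ : ℝ} (hC : 0 < C)
    (hR : DirichletApprox R C) (hτ : 2 < τ) {c ω : ℕ → ℝ} (hω : ∀ n, 0 < ω n)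
    (h : ∑' n, ENNReal.ofReal (ω n ^ (2 / τ)) < ENNReal.ofReal (1 / blockingConst C)) :
    ∃ x : ℝ, (∀ Q : ℕ, ∃ r ∈ R, Q ≤ r.den ∧ |x - r| ≤ invDenPow τ r) ∧
      ∀ n, x ∉ ball (c n) (ω n) := by
  classical
  let P : Type := {p : ℝ × ℝ // 0 < p.2 ∧ p.2 ≤ 1 ∧ meetSum c ω (2 / τ) (closedBall p.1 p.2) <
      ENNReal.ofReal (1 / blockingConst C * p.2 ^ (2 / τ))}
  have step : ∀ (p : P) (Q : ℕ), ∃ (p' : P) (r : ℚ), r ∈ R ∧ Q ≤ r.den ∧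
      p'.1 = ((r : ℝ), invDenPow τ r) ∧
      closedBall (r : ℝ) (invDenPow τ r) ⊆ closedBall p.1.1 p.1.2 := by
    rintro ⟨⟨x₀, ρ₀⟩, h0, h1, hlt⟩ Q
    obtain ⟨r, hr, hden, hsub, hm⟩ := exists_sub_ball hC hR hτ hω h0 h1 hlt Q
    exact ⟨⟨((r : ℝ), invDenPow τ r), invDenPow_pos τ r, invDenPow_le_one (by linarith) r, hm⟩,
      r, hr, hden, rfl, hsub⟩
  choose next q hqR hqden hqeq hqsub using step
  let p₀ : P := ⟨(0, 1), one_pos, le_rfl, by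
    rw [Real.one_rpow, mul_one]
    refine lt_of_le_of_lt (ENNReal.tsum_le_tsum fun n => ?_) h
    split_ifs
    exacts [le_rfl, zero_le]⟩
  let p : ℕ → P := fun n => Nat.rec p₀ (fun k pk => next pk k) n
  have hp : ∀ k, p (k + 1) = next (p k) k := fun _ => rfl
  have hpeq : ∀ k, (p (k + 1)).1 = ((q (p k) k : ℝ), invDenPow τ (q (p k) k)) := fun k => hqeq _ _
  obtain ⟨x, hx⟩ := IsCompact.nonempty_iInter_of_sequence_nonempty_isCompact_isClosed
    (fun k => closedBall (p k).1.1 (p k).1.2)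
    (fun k => by simp only [hpeq k]; exact hqsub (p k) k)
    (fun k => ⟨_, mem_closedBall_self (p k).2.1.le⟩)
    (isCompact_closedBall _ _) (fun k => isClosed_closedBall)
  rw [Set.mem_iInter] at hx
  refine ⟨x, fun Q => ⟨q (p Q) Q, hqR _ _, hqden _ _, ?_⟩, fun n hn => ?_⟩
  · have := hx (Q + 1)
    simp only [hpeq Q] at this
    rwa [mem_closedBall, Real.dist_eq] at this
  · have hpos : 0 < ω n ^ (2 / τ) := Real.rpow_pos_of_pos (hω n) _
    obtain ⟨Q, hQ⟩ := exists_den_invDenSq_le hpos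
    have hm := (p (Q + 1)).2.2.2
    have h1 := (le_meetSum (s := 2 / τ) ⟨x, hn, hx (Q + 1)⟩).trans_lt hm
    simp only [hpeq Q] at h1
    rw [invDenPow_rpow (by linarith)] at h1
    have h2 := hQ _ (hqden (p Q) Q)
    have hb2 := two_le_blockingConst hC
    have h3 : 1 / blockingConst C ≤ 1 := by rw [div_le_one (by linarith)]; linarith
    have h4 := mul_le_mul_of_nonneg_right h3 (invDenSq_pos (q (p Q) Q)).le
    have h5 := (ENNReal.ofReal_lt_ofReal_iff_of_nonneg hpos.le).1 h1
    linarith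

/-! ### From vanishing Hausdorff measure to ball covers. -/

/-- A set of vanishing Hausdorff measure is covered by balls of small total weight. -/
lemma exists_ball_cover_of_hausdorffMeasure_zero {s : ℝ} (hs0 : 0 < s) (hs1 : s ≤ 1) {A : Set ℝ}
    (hA : μH[s] A = 0) {ε : ℝ≥0∞} (hε : ε ≠ 0) :
    ∃ c ω : ℕ → ℝ, (∀ n, 0 < ω n) ∧ A ⊆ ⋃ n, ball (c n) (ω n) ∧
      ∑' n, ENNReal.ofReal (ω n ^ s) < ε := by
  have hε2 : ε / 2 ≠ 0 := (ENNReal.half_pos hε).ne'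
  rw [Measure.hausdorffMeasure_apply] at hA
  -- The scale 1 serves only to make the diameters finite.
  have h1 := le_of_le_of_eq (le_iSup₂ (f := fun (r : ℝ≥0∞) (_ : 0 < r) =>
    ⨅ (t : ℕ → Set ℝ) (_ : A ⊆ ⋃ n, t n) (_ : ∀ n, ediam (t n) ≤ r),
      ∑' n, ⨆ (_ : (t n).Nonempty), ediam (t n) ^ s) 1 one_pos) hA
  have h2 := lt_of_le_of_lt h1 (pos_iff_ne_zero.2 hε2)
  simp only [iInf_lt_iff] at h2
  obtain ⟨t, htA, htd, hts⟩ := h2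
  obtain ⟨δ, hδ0, hδ⟩ := ENNReal.exists_pos_sum_of_countable hε2 ℕ
  have hfin : ∀ n, ediam (t n) ≠ ∞ := fun n => ne_top_of_le_ne_top ENNReal.one_ne_top (htd n)
  have hc : ∀ n, ∃ c : ℝ, (t n).Nonempty → c ∈ t n := fun n => by
    by_cases h : (t n).Nonempty
    · exact ⟨h.some, fun _ => h.some_mem⟩
    · exact ⟨0, fun h' => absurd h' h⟩
  choose c hc using hc
  have hδpos : ∀ n, 0 < (δ n : ℝ) ^ (1 / s) := fun n => Real.rpow_pos_of_pos (hδ0 n) _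
  -- Open balls need a radius above the diameter. The excess has s-th power `δ n`, so subadditivity
  -- of t ↦ t^s for `s ≤ 1` makes the total cost ∑ `δ n`.
  refine ⟨c, fun n => (ediam (t n)).toReal + (δ n : ℝ) ^ (1 / s),
    fun n => add_pos_of_nonneg_of_pos ENNReal.toReal_nonneg (hδpos n), ?_, ?_⟩
  · intro x hx
    obtain ⟨n, hn⟩ := Set.mem_iUnion.1 (htA hx)
    refine Set.mem_iUnion.2 ⟨n, ?_⟩
    rw [mem_ball, dist_edist]
    have := ENNReal.toReal_mono (hfin n) (edist_le_ediam_of_mem hn (hc n ⟨x, hn⟩))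
    have := hδpos n
    linarith
  · have hterm : ∀ n, ENNReal.ofReal (((ediam (t n)).toReal + (δ n : ℝ) ^ (1 / s)) ^ s) ≤
        (⨆ (_ : (t n).Nonempty), ediam (t n) ^ s) + δ n := by
      intro n
      have e1 : ediam (t n) ^ s ≤ ⨆ (_ : (t n).Nonempty), ediam (t n) ^ s := by
        rcases (t n).eq_empty_or_nonempty with h | h
        · simp [h, hs0]
        · exact le_iSup (fun _ : (t n).Nonempty => ediam (t n) ^ s) h
      have e2 : ENNReal.ofReal ((δ n : ℝ) ^ (1 / s)) ^ s = δ n := by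
        rw [ENNReal.ofReal_rpow_of_pos (hδpos n), ← Real.rpow_mul (δ n).coe_nonneg,
          one_div_mul_cancel hs0.ne', Real.rpow_one, ENNReal.ofReal_coe_nnreal]
      rw [← ENNReal.ofReal_rpow_of_pos
        (add_pos_of_nonneg_of_pos ENNReal.toReal_nonneg (hδpos n)),
        ENNReal.ofReal_add ENNReal.toReal_nonneg (hδpos n).le, ENNReal.ofReal_toReal (hfin n)]
      refine (ENNReal.rpow_add_le_add_rpow _ _ hs0.le hs1).trans ?_
      rw [e2]
      gcongr
    calc _ ≤ ∑' n, ((⨆ (_ : (t n).Nonempty), ediam (t n) ^ s) + (δ n : ℝ≥0∞)) :=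
          ENNReal.tsum_le_tsum hterm
      _ = _ := ENNReal.tsum_add
      _ < ε / 2 + ε / 2 := ENNReal.add_lt_add hts hδ
      _ = ε := ENNReal.add_halves ε

theorem hausdorffMeasure_approximable_ne_zero {R : Set ℚ} {C τ : ℝ} (hC : 0 < C)
    (hR : DirichletApprox R C) (hτ : 2 < τ) :
    μH[2 / τ] {x : ℝ | ∀ Q : ℕ, ∃ r ∈ R, Q ≤ r.den ∧ |x - r| ≤ invDenPow τ r} ≠ 0 := by
  intro h0
  have hb2 := two_le_blockingConst hC
  obtain ⟨c, ω, hω, hcov, hsum⟩ := exists_ball_cover_of_hausdorffMeasure_zero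
    (by positivity) ((div_le_one (by linarith)).2 hτ.le) h0
    (ε := ENNReal.ofReal (1 / blockingConst C))
    (by rw [Ne, ENNReal.ofReal_eq_zero, not_le]; positivity)
  obtain ⟨x, hx, hxn⟩ := exists_approximable_notMem_iUnion hC hR hτ hω hsum
  obtain ⟨n, hn⟩ := Set.mem_iUnion.1 (hcov hx)
  exact hxn n hn

/-! ### Approximants of large denominator. -/

open Matrix.SpecialLinearGroup (mapGL)

lemma finite_rat_den_le (x B : ℝ) (Q : ℕ) : {r : ℚ | r.den ≤ Q ∧ |x - r| ≤ B}.Finite := by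
  have hfin : ((Set.Icc (-⌈(|x| + B) * Q⌉) ⌈(|x| + B) * Q⌉) ×ˢ (Set.Iic Q) : Set (ℤ × ℕ)).Finite :=
    (Set.finite_Icc _ _).prod (Set.finite_Iic _)
  refine Set.Finite.of_injOn (f := fun r : ℚ => (r.num, r.den)) ?_ ?_ hfin
  · rintro r ⟨hden, hx⟩
    refine Set.mk_mem_prod ?_ hden
    have h1 := den_cast_pos r
    have h2 : (r.num : ℝ) = r * r.den := by exact_mod_cast (Rat.mul_den_eq_num r).symm
    have h3 : |(r : ℝ)| ≤ |x| + B := by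
      have := abs_sub_abs_le_abs_sub (r : ℝ) x
      rw [abs_sub_comm (r : ℝ) x] at this
      linarith
    have h4 : |(r.num : ℝ)| ≤ (|x| + B) * Q := by
      rw [h2, abs_mul, abs_of_pos h1]
      have : (r.den : ℝ) ≤ Q := by exact_mod_cast hden
      have := (abs_nonneg _).trans h3
      gcongr
    have h5 := h4.trans (Int.le_ceil _)
    rw [← Int.cast_abs, Int.cast_le] at h5
    exact Set.mem_Icc.2 (abs_le.1 h5)
  · intro r _ r' _ h
    exact Rat.ext (Prod.ext_iff.1 h).1 (Prod.ext_iff.1 h).2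

/-- Only finitely many rationals at bounded distance from `x` have bounded denominator, so
infinitude amounts to unbounded denominators. -/
lemma mem_approxSet_iff {Γ : Subgroup SL(2, ℤ)} {𝔞 : OnePoint ℚ} {τ : ℝ} (hτ : 0 ≤ τ) {x : ℝ} :
    x ∈ approxSet Γ 𝔞 τ ↔ ∃ C : ℝ, ∀ Q : ℕ, ∃ r : ℚ, CuspEquiv Γ (r : OnePoint ℚ) 𝔞 ∧ Q ≤ r.den ∧
      |x - r| ≤ C * invDenPow τ r := by
  have hdiv : ∀ (C : ℝ) (r : ℚ), C / (r.den : ℝ) ^ τ = C * invDenPow τ r := fun C r => by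
    unfold invDenPow; ring
  simp only [approxSet, Set.mem_ofPred_eq, hdiv]
  refine exists_congr fun C => ⟨fun hinf Q => ?_, fun h hfin => ?_⟩
  · by_contra hcon
    push Not at hcon
    refine hinf ((finite_rat_den_le x |C| Q).subset ?_)
    rintro r ⟨hr, hxr⟩
    refine ⟨?_, hxr.trans ?_⟩
    · by_contra hlt
      exact absurd hxr (hcon r hr (by omega)).not_ge
    · calc C * invDenPow τ r ≤ |C| * invDenPow τ r :=
            mul_le_mul_of_nonneg_right (le_abs_self C) (invDenPow_pos τ r).le
        _ ≤ |C| := mul_le_of_le_one_right (abs_nonneg C) (invDenPow_le_one hτ r)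
  · obtain ⟨r, hr, hden, hx⟩ := h (hfin.toFinset.sup Rat.den + 1)
    have := Finset.le_sup (f := Rat.den) (hfin.mem_toFinset.2 ⟨hr, hx⟩)
    omega

lemma exists_rat_approx_den_ge {x : ℝ} (hx : Irrational x) (Q : ℕ) :
    ∃ r : ℚ, Q ≤ r.den ∧ |x - r| ≤ invDenSq r := by
  by_contra hcon
  push Not at hcon
  refine Real.infinite_rat_abs_sub_lt_one_div_den_sq_of_irrational hx
    ((finite_rat_den_le x 1 Q).subset ?_)
  intro r hr
  have hr' : |x - r| < invDenSq r := hr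
  refine ⟨?_, hr'.le.trans (invDenSq_le_one r)⟩
  by_contra hlt
  exact absurd hr' (hcon r (by omega)).not_gt

/-! ### Dirichlet's theorem in the orbit of a cusp. -/

lemma mapGL_apply_rat (g : SL(2, ℤ)) (i j : Fin 2) :
    ((mapGL ℚ g : GL (Fin 2) ℚ) : Matrix (Fin 2) (Fin 2) ℚ) i j = (g i j : ℚ) := by
  simp [mapGL]

lemma mapGL_smul_infty (g : SL(2, ℤ)) (h : g 1 0 ≠ 0) :
    mapGL ℚ g • (OnePoint.infty : OnePoint ℚ) = (((g 0 0 : ℚ) / (g 1 0 : ℚ) : ℚ) : OnePoint ℚ) := by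
  classical
  rw [OnePoint.smul_infty_eq_ite, mapGL_apply_rat, mapGL_apply_rat, if_neg (by exact_mod_cast h)]

lemma mapGL_neg_smul_infty (g : SL(2, ℤ)) :
    mapGL ℚ (-g) • (OnePoint.infty : OnePoint ℚ) = mapGL ℚ g • OnePoint.infty := by
  classical
  simp only [OnePoint.smul_infty_eq_ite, mapGL_apply_rat]
  simp

lemma mapGL_T_zpow_smul (n : ℤ) (r : ℚ) :
    mapGL ℚ (ModularGroup.T ^ n) • (r : OnePoint ℚ) = ((r + n : ℚ) : OnePoint ℚ) := by
  classical
  rw [OnePoint.smul_some_eq_ite]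
  simp only [mapGL_apply_rat, ModularGroup.coe_T_zpow]
  simp

lemma exists_pos_T_zpow_mem_normalCore (Γ : Subgroup SL(2, ℤ)) [Γ.FiniteIndex] :
    ∃ N : ℤ, 0 < N ∧ ModularGroup.T ^ N ∈ Γ.normalCore := by
  obtain ⟨n, hn, -, h⟩ := Subgroup.exists_pow_mem_of_index_ne_zero
    (Subgroup.FiniteIndex.index_ne_zero (H := Γ.normalCore)) ModularGroup.T
  exact ⟨n, by exact_mod_cast hn, by exact_mod_cast h⟩

/-- Left translation by `±T ^ n` makes the first column of an integer matrix nonnegative. -/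
lemma exists_T_zpow_mul_column_nonneg (h : SL(2, ℤ)) {N : ℤ} (hN : 0 < N) :
    ∃ (k : ℤ) (h' : SL(2, ℤ)), (h' = h ∨ h' = -h) ∧
      1 ≤ (ModularGroup.T ^ (N * k) * h') 0 0 ∧ 0 ≤ (ModularGroup.T ^ (N * k) * h') 1 0 := by
  have hcol : ∀ (n : ℤ) (m : SL(2, ℤ)), (ModularGroup.T ^ n * m) 0 0 = m 0 0 + n * m 1 0 ∧
      (ModularGroup.T ^ n * m) 1 0 = m 1 0 := by
    intro n m
    simp [ModularGroup.coe_T_zpow, Matrix.mul_apply, Fin.sum_univ_two]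
  have main : ∀ m : SL(2, ℤ), (0 < m 1 0 ∨ m 1 0 = 0 ∧ 1 ≤ m 0 0) →
      ∃ k : ℤ, 1 ≤ (ModularGroup.T ^ (N * k) * m) 0 0 ∧
        0 ≤ (ModularGroup.T ^ (N * k) * m) 1 0 := by
    intro m hm
    -- When the lower entry is positive, each unit of `k` raises the upper entry by at least 1.
    refine ⟨|m 0 0| + 1, ?_⟩
    rw [(hcol _ m).1, (hcol _ m).2]
    rcases hm with hm | ⟨hm, hm'⟩
    · refine ⟨?_, hm.le⟩
      have h1 := neg_abs_le (m 0 0)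
      have h2 : 1 ≤ N * m 1 0 := Int.add_one_le_iff.2 (mul_pos hN hm) |>.trans' (by simp)
      have h3 := mul_le_mul_of_nonneg_left h2 (by positivity : 0 ≤ |m 0 0| + 1)
      linarith
    · rw [hm]; simpa using hm'
  have hdet := h.det_coe
  rw [Matrix.det_fin_two] at hdet
  have hneg : ∀ i j, (-h) i j = -(h i j) := fun i j => by simp
  rcases lt_trichotomy (h 1 0) 0 with hc | hc | hc
  · obtain ⟨k, hk⟩ := main (-h) (Or.inl (by rw [hneg]; omega))
    exact ⟨k, _, Or.inr rfl, hk⟩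
  · have ha : h 0 0 ≠ 0 := fun ha => by rw [ha, hc] at hdet; simp at hdet
    rcases lt_or_gt_of_ne ha with ha | ha
    · obtain ⟨k, hk⟩ := main (-h) (Or.inr (by rw [hneg, hneg]; omega))
      exact ⟨k, _, Or.inr rfl, hk⟩
    · obtain ⟨k, hk⟩ := main h (Or.inr ⟨hc, ha⟩)
      exact ⟨k, _, Or.inl rfl, hk⟩
  · obtain ⟨k, hk⟩ := main h (Or.inl hc)
    exact ⟨k, _, Or.inl rfl, hk⟩

/-- Every `g` may be multiplied on the right by a matrix whose first column is nonnegative and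
bounded independently of `g` so that the product maps `∞` into the orbit of `𝔞`. -/
lemma exists_bounded_column (Γ : Subgroup SL(2, ℤ)) [Γ.FiniteIndex] (𝔞 : OnePoint ℚ) :
    ∃ K : ℕ, ∀ g : SL(2, ℤ), ∃ h : SL(2, ℤ), 1 ≤ h 0 0 ∧ h 0 0 ≤ K ∧ 0 ≤ h 1 0 ∧ h 1 0 ≤ K ∧
      ∃ γ ∈ Γ, mapGL ℚ γ • 𝔞 = mapGL ℚ (g * h) • (OnePoint.infty : OnePoint ℚ) := by
  classical
  obtain ⟨σ, rfl⟩ := OnePoint.exists_mem_SL2 ℤ 𝔞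
  obtain ⟨N, hN, hT⟩ := exists_pos_T_zpow_mem_normalCore Γ
  have hcoset : ∀ q : SL(2, ℤ) ⧸ Γ, ∃ h : SL(2, ℤ), 1 ≤ h 0 0 ∧ 0 ≤ h 1 0 ∧
      ∀ g : SL(2, ℤ), (QuotientGroup.mk g⁻¹ : SL(2, ℤ) ⧸ Γ) = q →
        ∃ γ ∈ Γ, mapGL ℚ γ • (mapGL ℚ σ • (OnePoint.infty : OnePoint ℚ)) =
          mapGL ℚ (g * h) • (OnePoint.infty : OnePoint ℚ) := by
    intro q
    obtain ⟨ρ, rfl⟩ := QuotientGroup.mk_surjective q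
    -- If gρ ∈ Γ, then g T^(Nk) ρσ = (g T^(Nk) g⁻¹)(gρ)σ lies in Γσ, the first factor because T^N is
    -- in the normal core. Thus the multiplier depends only on the coset of g⁻¹, and the sign acts
    -- trivially.
    obtain ⟨k, h', hh', h00, h10⟩ := exists_T_zpow_mul_column_nonneg (ρ * σ) hN
    refine ⟨_, h00, h10, fun g hg => ?_⟩
    have hgρ : g * ρ ∈ Γ := by
      have := QuotientGroup.eq.1 hg
      simpa using this
    have hTk : ModularGroup.T ^ (N * k) ∈ Γ.normalCore := by
      rw [zpow_mul]; exact Subgroup.zpow_mem _ hT k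
    have hconj : g * ModularGroup.T ^ (N * k) * g⁻¹ ∈ Γ := hTk g
    refine ⟨_, Γ.mul_mem hconj hgρ, ?_⟩
    rw [← mul_smul, ← map_mul]
    rcases hh' with rfl | rfl
    · congr 2; group
    · rw [mul_neg, mul_neg, mapGL_neg_smul_infty]
      congr 2; group
  choose f hf using hcoset
  have : Fintype (SL(2, ℤ) ⧸ Γ) := Fintype.ofFinite _
  refine ⟨Finset.univ.sup fun q => ((f q) 0 0).natAbs + ((f q) 1 0).natAbs, fun g => ?_⟩
  have hle := Finset.le_sup (f := fun q => ((f q) 0 0).natAbs + ((f q) 1 0).natAbs)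
    (Finset.mem_univ (QuotientGroup.mk g⁻¹ : SL(2, ℤ) ⧸ Γ))
  obtain ⟨h1, h2, h3⟩ := hf (QuotientGroup.mk g⁻¹)
  refine ⟨f (QuotientGroup.mk g⁻¹), h1, ?_, h2, ?_, h3 g rfl⟩ <;> omega

/-- Bézout completes the column; subtracting a multiple of it from the second column reduces the
lower right entry modulo `r.den`. This keeps the denominators of later products comparable to
`r.den`. -/
lemma exists_SL2_of_rat (r : ℚ) : ∃ g : SL(2, ℤ), g 0 0 = r.num ∧ g 1 0 = r.den ∧
    0 ≤ g 1 1 ∧ g 1 1 ≤ r.den := by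
  have hcop : IsCoprime r.num (r.den : ℤ) := Int.isCoprime_iff_gcd_eq_one.2 r.reduced
  obtain ⟨a, b, hab⟩ := hcop
  have hpos : (0 : ℤ) < r.den := by exact_mod_cast r.pos
  have hmod := Int.emod_add_mul_ediv a r.den
  refine ⟨⟨!![r.num, -(b + r.num * (a / r.den)); r.den, a % r.den], ?_⟩, rfl, rfl,
    Int.emod_nonneg _ hpos.ne', (Int.emod_lt_of_pos _ hpos).le⟩
  rw [Matrix.det_fin_two_of]
  linear_combination r.num * hmod + hab

lemma cuspEquiv_of_eq {Γ : Subgroup SL(2, ℤ)} {𝔞 𝔟 : OnePoint ℚ} {γ : SL(2, ℤ)} (hγ : γ ∈ Γ)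
    (h : mapGL ℚ γ • 𝔞 = 𝔟) : CuspEquiv Γ 𝔟 𝔞 :=
  ⟨γ⁻¹, Γ.inv_mem hγ, by rw [moebius, ← h, map_inv, inv_smul_smul]⟩

/-- The orbit of a cusp satisfies Dirichlet's approximation theorem up to a constant. -/
theorem exists_dirichletApprox (Γ : Subgroup SL(2, ℤ)) [Γ.FiniteIndex] (𝔞 : OnePoint ℚ) :
    ∃ C : ℝ, 0 < C ∧ DirichletApprox {r : ℚ | CuspEquiv Γ (r : OnePoint ℚ) 𝔞} C := by
  obtain ⟨K, hK⟩ := exists_bounded_column Γ 𝔞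
  have hK1 : (1 : ℝ) ≤ K := by
    obtain ⟨h, h1, h2, -⟩ := hK 1
    exact_mod_cast (by omega : 1 ≤ K)
  -- The error is at most `(1 + K) * invDenSq r`, and the new denominator is at most `2 * K *
  -- r.den`.
  refine ⟨(1 + K) * (2 * K) ^ 2, by positivity, fun x hx Q => ?_⟩
  obtain ⟨r, hden, hxr⟩ := exists_rat_approx_den_ge hx Q
  obtain ⟨g, hg00, hg10, hg0, hg1⟩ := exists_SL2_of_rat r
  obtain ⟨h, hu1, huK, hv0, hvK, γ, hγ, hγ𝔞⟩ := hK g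
  have hd : (1 : ℤ) ≤ r.den := by exact_mod_cast r.pos
  have hP : (g * h) 0 0 = r.num * h 0 0 + g 0 1 * h 1 0 := by
    rw [← hg00]; simp [Matrix.mul_apply, Fin.sum_univ_two]
  have hD : (g * h) 1 0 = r.den * h 0 0 + g 1 1 * h 1 0 := by
    rw [← hg10]; simp [Matrix.mul_apply, Fin.sum_univ_two]
  have hDge : (r.den : ℤ) ≤ (g * h) 1 0 := by
    rw [hD]
    have := mul_nonneg hg0 hv0
    nlinarith
  have hDle : (g * h) 1 0 ≤ 2 * K * r.den := by
    rw [hD]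
    have e1 := mul_le_mul_of_nonneg_left huK (by omega : (0 : ℤ) ≤ r.den)
    have e2 := mul_le_mul hg1 hvK hv0 (by omega)
    linarith
  have hdet := g.det_coe
  rw [Matrix.det_fin_two, hg00, hg10] at hdet
  have hdet' := (g * h).det_coe
  rw [Matrix.det_fin_two] at hdet'
  have hcop : Nat.Coprime ((g * h) 0 0).natAbs ((g * h) 1 0).natAbs := by
    apply Int.isCoprime_iff_gcd_eq_one.1
    exact ⟨(g * h) 1 1, -(g * h) 0 1, by linear_combination hdet'⟩
  have hDpos : 0 < (g * h) 1 0 := by omega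
  have hcast : ((((g * h) 0 0 : ℤ) : ℚ) / (((g * h) 1 0 : ℤ) : ℚ)).den = ((g * h) 1 0) :=
    Rat.den_div_eq_of_coprime hDpos hcop
  rw [mapGL_smul_infty _ hDpos.ne'] at hγ𝔞
  generalize hP' : (g * h) 0 0 = P at *
  generalize hD' : (g * h) 1 0 = D at *
  refine ⟨(P : ℚ) / (D : ℚ), cuspEquiv_of_eq hγ hγ𝔞, ?_, ?_⟩
  · have := hcast; omega
  · have hcastR : ((((P : ℚ) / (D : ℚ)).den : ℕ) : ℝ) = D := by exact_mod_cast hcast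
    have hdR : (1 : ℝ) ≤ r.den := one_le_den_cast r
    have hDR : (r.den : ℝ) ≤ D := by exact_mod_cast hDge
    have hDR' : (D : ℝ) ≤ 2 * K * r.den := by exact_mod_cast hDle
    have hDpos' : (0 : ℝ) < D := by linarith
    have hnum : (r : ℝ) = r.num / r.den := by exact_mod_cast (Rat.num_div_den r).symm
    -- The cross difference of the two fractions is `h 1 0` times the determinant of `g`.
    have hdiff : (r : ℝ) - (P : ℝ) / D = h 1 0 / (r.den * D) := by
      rw [hnum, div_sub_div _ _ (by positivity) hDpos'.ne']
      congr 1
      have : r.num * D - r.den * P = h 1 0 := by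
        rw [hP, hD]; linear_combination (h 1 0) * hdet
      exact_mod_cast this
    have hvR : (0 : ℝ) ≤ h 1 0 := by exact_mod_cast hv0
    have hvR' : ((h 1 0 : ℤ) : ℝ) ≤ K := by exact_mod_cast hvK
    have hdiff' : |(r : ℝ) - (P : ℝ) / D| ≤ K * invDenSq r := by
      rw [hdiff, abs_of_nonneg (by positivity), invDenSq, mul_one_div, pow_two]
      gcongr
    have hsq : invDenSq r ≤ (2 * K) ^ 2 * invDenSq ((P : ℚ) / (D : ℚ)) := by
      unfold invDenSq
      rw [hcastR, mul_one_div, div_le_div_iff₀ (by positivity) (by positivity), ← mul_pow, one_mul]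
      gcongr
    push_cast
    calc |x - (P : ℝ) / D| ≤ |x - r| + |(r : ℝ) - (P : ℝ) / D| := abs_sub_le _ _ _
      _ ≤ (1 + K) * invDenSq r := by linarith
      _ ≤ (1 + K) * ((2 * K) ^ 2 * invDenSq ((P : ℚ) / (D : ℚ))) := by gcongr
      _ = _ := by ring

/-! ### Periodicity. -/

/-- Integer translations keep denominators, and those in `Γ` preserve the orbit. -/
lemma approxSet_add_mem {Γ : Subgroup SL(2, ℤ)} {𝔞 : OnePoint ℚ} {τ : ℝ} (hτ : 0 ≤ τ) {n : ℤ}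
    (hn : ModularGroup.T ^ n ∈ Γ) {x : ℝ} (hx : x ∈ approxSet Γ 𝔞 τ) :
    x + n ∈ approxSet Γ 𝔞 τ := by
  rw [mem_approxSet_iff hτ] at hx ⊢
  obtain ⟨C, h⟩ := hx
  refine ⟨C, fun Q => ?_⟩
  obtain ⟨r, ⟨γ, hγ, h𝔞⟩, hden, hxr⟩ := h Q
  have hden' : (r + n : ℚ).den = r.den := Rat.add_intCast_den r n
  refine ⟨r + n, ⟨γ * (ModularGroup.T ^ n)⁻¹, Γ.mul_mem hγ (Γ.inv_mem hn), ?_⟩, ?_, ?_⟩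
  · rw [h𝔞, moebius, moebius, ← mapGL_T_zpow_smul, map_mul, map_inv, mul_smul, inv_smul_smul]
  · rwa [hden']
  · rw [invDenPow, hden']
    push_cast
    rw [add_sub_add_right_eq_sub]
    exact hxr

/-- The Hausdorff measure of a periodic set of real numbers is zero or infinite. -/
lemma hausdorffMeasure_eq_top_of_periodic {s p : ℝ} (hs : 0 ≤ s) (hp : 0 < p) {A : Set ℝ}
    (hper : ∀ (k : ℤ), ∀ x ∈ A, x + k * p ∈ A) (h0 : μH[s] A ≠ 0) : μH[s] A = ∞ := by
  -- `A` is not assumed measurable; additivity is applied to the intervals under the restricted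
  -- measure.
  have hdecomp : μH[s] A = ∑' k : ℤ, μH[s] (Set.Ico (0 + k • p) (0 + (k + 1) • p) ∩ A) := by
    calc μH[s] A = (μH[s]).restrict A (⋃ k : ℤ, Set.Ico (0 + k • p) (0 + (k + 1) • p)) := by
          rw [iUnion_Ico_add_zsmul hp, Measure.restrict_apply_univ]
      _ = ∑' k : ℤ, (μH[s]).restrict A (Set.Ico (0 + k • p) (0 + (k + 1) • p)) :=
          measure_iUnion (Set.pairwise_disjoint_Ico_add_zsmul 0 p) fun _ => measurableSet_Ico
      _ = _ := by simp only [Measure.restrict_apply measurableSet_Ico]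
  have hconst : ∀ k : ℤ, μH[s] (Set.Ico (0 + k • p) (0 + (k + 1) • p) ∩ A) =
      μH[s] (Set.Ico 0 p ∩ A) := by
    intro k
    have himg : Set.Ico (0 + k • p) (0 + (k + 1) • p) ∩ A =
        (fun x => x + k * p) '' (Set.Ico 0 p ∩ A) := by
      ext x
      simp only [Set.mem_inter_iff, Set.mem_Ico, Set.mem_image, zsmul_eq_mul, zero_add]
      push_cast
      constructor
      · rintro ⟨⟨h1, h2⟩, hx⟩
        refine ⟨x + (-k : ℤ) * p, ⟨⟨?_, ?_⟩, hper _ x hx⟩, ?_⟩ <;> push_cast <;> linarith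
      · rintro ⟨y, ⟨⟨h1, h2⟩, hy⟩, rfl⟩
        exact ⟨⟨by linarith, by linarith⟩, hper k y hy⟩
    rw [himg]
    exact (isometry_add_right ((k : ℝ) * p)).hausdorffMeasure_image (Or.inl hs) _
  simp only [hconst] at hdecomp
  rw [hdecomp]
  apply ENNReal.tsum_const_eq_top_of_ne_zero
  intro hzero
  rw [hzero, tsum_zero] at hdecomp
  exact h0 hdecomp

/-! ### The upper bound for the dimension. -/

lemma card_Icc_neg_le (B : ℝ) (hB : 0 ≤ B) :
    ((Finset.Icc (-⌈B⌉) ⌈B⌉).card : ℝ) ≤ 2 * B + 3 := by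
  rw [Int.card_Icc]
  have h0 : 0 ≤ ⌈B⌉ := Int.ceil_nonneg hB
  have h1 := (Int.ceil_lt_add_one B).le
  have h2 : (((⌈B⌉ + 1 - -⌈B⌉).toNat : ℕ) : ℝ) = 2 * ⌈B⌉ + 1 := by
    have : (((⌈B⌉ + 1 - -⌈B⌉).toNat : ℕ) : ℤ) = 2 * ⌈B⌉ + 1 := by omega
    exact_mod_cast this
  rw [h2]
  linarith

/-- Bounded numbers that are approximable to order `τ` have finite `s`-measure for `2 < τ s`. -/
lemma hausdorffMeasure_bounded_approximable_ne_top {τ s : ℝ} (hτ : 0 < τ) (hs : 2 < τ * s)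
    (n : ℕ) :
    μH[s] {x : ℝ | |x| ≤ n ∧ ∀ Q : ℕ, ∃ r : ℚ, Q ≤ r.den ∧ |x - r| ≤ n * invDenPow τ r} ≠ ∞ := by
  have hs0 : 0 < s := by
    by_contra hle
    nlinarith
  -- The index `q` stands for the denominator `q + 1`. The approximants satisfy |r| ≤ 2n, which
  -- bounds the numerators; unreduced fractions only enlarge the cover.
  let ι : Type := Σ q : ℕ, Finset.Icc (-⌈(2 * n * (q + 1) : ℝ)⌉) ⌈(2 * n * (q + 1) : ℝ)⌉
  let t : ℕ → ι → Set ℝ := fun Q i =>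
    if Q ≤ i.1 then closedBall ((i.2 : ℤ) / ((i.1 : ℝ) + 1)) (n / ((i.1 : ℝ) + 1) ^ τ) else ∅
  have htend : Tendsto (fun Q : ℕ => ENNReal.ofReal (2 * (n / ((Q : ℝ) + 1) ^ τ))) atTop (𝓝 0) := by
    rw [← ENNReal.ofReal_zero]
    refine ENNReal.tendsto_ofReal ?_
    rw [← mul_zero (2 : ℝ)]
    refine Tendsto.const_mul 2 (Tendsto.const_div_atTop ?_ _)
    exact (tendsto_rpow_atTop hτ).comp
      (tendsto_atTop_add_const_right _ _ tendsto_natCast_atTop_atTop)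
  have hdiam : ∀ Q : ℕ, ∀ i : ι, ediam (t Q i) ≤ ENNReal.ofReal (2 * (n / ((Q : ℝ) + 1) ^ τ)) := by
    intro Q i
    by_cases hQ : Q ≤ i.1
    · simp only [t, if_pos hQ]
      rw [Real.closedBall_eq_Icc, Real.ediam_Icc]
      apply ENNReal.ofReal_le_ofReal
      have : (n : ℝ) / ((i.1 : ℝ) + 1) ^ τ ≤ n / ((Q : ℝ) + 1) ^ τ := by gcongr
      linarith
    · simp [t, if_neg hQ]
  have hcov : ∀ Q : ℕ, {x : ℝ | |x| ≤ n ∧ ∀ Q : ℕ, ∃ r : ℚ, Q ≤ r.den ∧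
      |x - r| ≤ n * invDenPow τ r} ⊆ ⋃ i, t Q i := by
    rintro Q x ⟨hxn, hx⟩
    obtain ⟨r, hden, hxr⟩ := hx (Q + 1)
    have hr0 := den_cast_pos r
    obtain ⟨q, hq⟩ : ∃ q, r.den = q + 1 := ⟨r.den - 1, by omega⟩
    have hqR : (r.den : ℝ) = q + 1 := by exact_mod_cast hq
    have hnum : (r.num : ℝ) = r * (q + 1) := by
      rw [← hqR]; exact_mod_cast (Rat.mul_den_eq_num r).symm
    have habs : |(r : ℝ)| ≤ 2 * n := by
      have e1 := abs_sub_abs_le_abs_sub (r : ℝ) x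
      rw [abs_sub_comm (r : ℝ) x] at e1
      have e2 : (n : ℝ) * invDenPow τ r ≤ n :=
        mul_le_of_le_one_right (by positivity) (invDenPow_le_one hτ.le r)
      linarith
    have hmem : r.num ∈ Finset.Icc (-⌈(2 * n * (q + 1) : ℝ)⌉) ⌈(2 * n * (q + 1) : ℝ)⌉ := by
      have h4 : |(r.num : ℝ)| ≤ 2 * n * (q + 1) := by
        rw [hnum, abs_mul, abs_of_pos (by positivity : (0 : ℝ) < q + 1)]
        gcongr
      have h5 := h4.trans (Int.le_ceil _)
      rw [← Int.cast_abs, Int.cast_le] at h5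
      exact Finset.mem_Icc.2 (abs_le.1 h5)
    refine Set.mem_iUnion.2 ⟨⟨q, ⟨r.num, hmem⟩⟩, ?_⟩
    simp only [t]
    rw [if_pos (by omega), mem_closedBall, Real.dist_eq, hnum,
      mul_div_cancel_right₀ _ (by positivity), ← hqR, div_eq_mul_one_div]
    exact hxr
  -- There are at most (4n+3)(q+1) numerators, each contributing at most (2n)^s (q+1)^(-τs); the
  -- series converges since τs - 1 > 1.
  have hsum : ∀ Q : ℕ, ∑' i, ediam (t Q i) ^ s ≤
      ∑' q : ℕ, ENNReal.ofReal ((4 * n + 3) * (2 * n) ^ s * (1 / ((q + 1 : ℕ) : ℝ) ^ (τ * s - 1))) := by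
    intro Q
    rw [ENNReal.tsum_sigma']
    refine ENNReal.tsum_le_tsum fun q => ?_
    have hq1 : (1 : ℝ) ≤ (q : ℝ) + 1 := by
      have : (0 : ℝ) ≤ q := by positivity
      linarith
    have hq0 : (0 : ℝ) < (q : ℝ) + 1 := by positivity
    have hterm : ∀ p : Finset.Icc (-⌈(2 * n * (q + 1) : ℝ)⌉) ⌈(2 * n * (q + 1) : ℝ)⌉,
        ediam (t Q ⟨q, p⟩) ^ s ≤ ENNReal.ofReal ((2 * (n / ((q : ℝ) + 1) ^ τ)) ^ s) := by
      intro p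
      rw [← ENNReal.ofReal_rpow_of_nonneg (by positivity) hs0.le]
      refine ENNReal.rpow_le_rpow ?_ hs0.le
      by_cases hQ : Q ≤ q
      · have := hdiam q ⟨q, p⟩
        simp only [t, le_refl, if_true, hQ] at this ⊢
        exact this
      · simp [t, if_neg hQ]
    refine (ENNReal.tsum_le_tsum hterm).trans ?_
    rw [tsum_fintype, Finset.sum_const, Finset.card_univ, Fintype.card_coe, nsmul_eq_mul,
      ← ENNReal.ofReal_natCast, ← ENNReal.ofReal_mul (by positivity)]
    apply ENNReal.ofReal_le_ofReal
    have hcard := card_Icc_neg_le (2 * n * (q + 1)) (by positivity)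
    have hcard' : ((Finset.Icc (-⌈(2 * n * (q + 1) : ℝ)⌉) ⌈(2 * n * (q + 1) : ℝ)⌉).card : ℝ) ≤
        (4 * n + 3) * (q + 1) := by nlinarith
    have hpow : (2 * (n / ((q : ℝ) + 1) ^ τ)) ^ s = (2 * n) ^ s * (1 / ((q : ℝ) + 1) ^ (τ * s)) := by
      rw [← mul_div_assoc, Real.div_rpow (by positivity) (by positivity), ← Real.rpow_mul hq0.le,
        mul_one_div]
    rw [hpow]
    push_cast
    calc _ ≤ (4 * n + 3) * ((q : ℝ) + 1) * ((2 * n) ^ s * (1 / ((q : ℝ) + 1) ^ (τ * s))) := by gcongr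
      _ = _ := by
        rw [Real.rpow_sub_one hq0.ne']; field_simp
  have hfin : ∑' q : ℕ, ENNReal.ofReal
      ((4 * n + 3) * (2 * n) ^ s * (1 / ((q + 1 : ℕ) : ℝ) ^ (τ * s - 1))) ≠ ∞ := by
    have hsm : Summable fun q : ℕ => 1 / ((q : ℕ) : ℝ) ^ (τ * s - 1) :=
      Real.summable_one_div_nat_rpow.2 (by linarith)
    exact (((summable_nat_add_iff 1).2 hsm).mul_left _).tsum_ofReal_ne_top
  refine ne_top_of_le_ne_top hfin ?_
  refine (Measure.hausdorffMeasure_le_liminf_tsum s _ _ htend t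
    (Eventually.of_forall hdiam) (Eventually.of_forall hcov)).trans ?_
  exact liminf_le_of_le (by isBoundedDefault) fun b hb => by
    obtain ⟨Q, hQ⟩ := hb.exists
    exact hQ.trans (hsum Q)

/-- One integer bounds both |x| and the constant, so countably many sets of finite t-measure, for
every t > 2/τ, cover the set. -/
theorem dimH_approxSet_le (Γ : Subgroup SL(2, ℤ)) (𝔞 : OnePoint ℚ) {τ : ℝ} (hτ : 0 < τ) :
    dimH (approxSet Γ 𝔞 τ) ≤ ENNReal.ofReal (2 / τ) := by
  have hsub : approxSet Γ 𝔞 τ ⊆ ⋃ n : ℕ, {x : ℝ | |x| ≤ n ∧ ∀ Q : ℕ, ∃ r : ℚ, Q ≤ r.den ∧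
      |x - r| ≤ n * invDenPow τ r} := by
    intro x hx
    obtain ⟨C, hC⟩ := (mem_approxSet_iff hτ.le).1 hx
    obtain ⟨n, hn⟩ := exists_nat_ge (max |x| C)
    refine Set.mem_iUnion.2 ⟨n, (le_max_left _ _).trans hn, fun Q => ?_⟩
    obtain ⟨r, -, hden, hxr⟩ := hC Q
    exact ⟨r, hden, hxr.trans (mul_le_mul_of_nonneg_right ((le_max_right _ _).trans hn)
      (invDenPow_pos τ r).le)⟩
  refine (dimH_mono hsub).trans ?_
  rw [dimH_iUnion]
  refine iSup_le fun n => le_of_forall_gt_imp_ge_of_dense fun d hd => ?_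
  rcases eq_or_ne d ∞ with rfl | hdtop
  · exact le_top
  lift d to NNReal using hdtop
  refine dimH_le_of_hausdorffMeasure_ne_top
    (hausdorffMeasure_bounded_approximable_ne_top hτ ?_ n)
  rw [ENNReal.ofReal_lt_iff_lt_toReal (by positivity) ENNReal.coe_ne_top, ENNReal.coe_toReal,
    div_lt_iff₀ hτ] at hd
  linarith

/-! ### Nonvanishing, infinite measure and the theorem. -/

/-- At τ = 2 the measure is Lebesgue measure and the irrationals already have full measure; the
covering argument needs 2/τ < 1. -/
lemma hausdorffMeasure_approxSet_ne_zero (Γ : Subgroup SL(2, ℤ)) [Γ.FiniteIndex] (𝔞 : OnePoint ℚ)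
    {τ : ℝ} (hτ : 2 ≤ τ) : μH[2 / τ] (approxSet Γ 𝔞 τ) ≠ 0 := by
  obtain ⟨C, hC, hR⟩ := exists_dirichletApprox Γ 𝔞
  rcases hτ.eq_or_lt with rfl | hlt
  · have hsub : {x : ℝ | Irrational x} ⊆ approxSet Γ 𝔞 2 := by
      intro x hx
      refine (mem_approxSet_iff zero_le_two).2 ⟨C, fun Q => ?_⟩
      obtain ⟨r, hr, hden, hxr⟩ := hR x hx Q
      refine ⟨r, hr, hden, ?_⟩
      rwa [← invDenPow_rpow two_pos r, div_self two_ne_zero, Real.rpow_one] at hxr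
    rw [div_self two_ne_zero, hausdorffMeasure_real]
    intro h0
    have hirr := measure_mono_null hsub h0
    have hrat := (Set.countable_range ((↑) : ℚ → ℝ)).measure_zero volume
    have huniv : (Set.univ : Set ℝ) ⊆ {x : ℝ | Irrational x} ∪ Set.range ((↑) : ℚ → ℝ) :=
      fun x _ => (em (Irrational x)).imp id fun h => by simpa [Irrational] using h
    have := measure_mono_null huniv (measure_union_null hirr hrat)
    simp at this
  · refine fun h0 => hausdorffMeasure_approximable_ne_zero hC hR hlt (measure_mono_null ?_ h0)
    intro x hx
    refine (mem_approxSet_iff (by linarith)).2 ⟨1, fun Q => ?_⟩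
    obtain ⟨r, hr, hden, hxr⟩ := hx Q
    exact ⟨r, hr, hden, by rwa [one_mul]⟩

lemma hausdorffMeasure_approxSet_eq_top (Γ : Subgroup SL(2, ℤ)) [Γ.FiniteIndex] (𝔞 : OnePoint ℚ)
    {τ : ℝ} (hτ : 2 ≤ τ) : μH[2 / τ] (approxSet Γ 𝔞 τ) = ∞ := by
  obtain ⟨N, hN, hT⟩ := exists_pos_T_zpow_mem_normalCore Γ
  refine hausdorffMeasure_eq_top_of_periodic (p := N) (by positivity) (by exact_mod_cast hN) ?_
    (hausdorffMeasure_approxSet_ne_zero Γ 𝔞 hτ)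
  intro k x hx
  have hTk : ModularGroup.T ^ (k * N) ∈ Γ := by
    rw [mul_comm, zpow_mul]
    exact Γ.zpow_mem (Γ.normalCore_le hT) k
  simpa using approxSet_add_mem (by linarith) hTk hx

theorem theorem6p2 (Γ : Subgroup SL(2, ℤ)) (hΓ : Γ.FiniteIndex) (𝔞 : OnePoint ℚ)
    (τ : ℝ) (hτ : 2 ≤ τ) :
    dimH (approxSet Γ 𝔞 τ) = ENNReal.ofReal (2 / τ) ∧
      Measure.hausdorffMeasure (2 / τ) (approxSet Γ 𝔞 τ) = ∞ := by
  have htop := hausdorffMeasure_approxSet_eq_top Γ 𝔞 hτ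
  refine ⟨le_antisymm (dimH_approxSet_le Γ 𝔞 (by linarith)) ?_, htop⟩
  refine le_dimH_of_hausdorffMeasure_ne_zero (d := (2 / τ).toNNReal) ?_
  rw [Real.coe_toNNReal _ (by positivity), htop]
  exact ENNReal.top_ne_zero
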